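/- Let $A\in\mathbb{R}^{n\times n}$, let $C\in\mathbb{R}^{p\times n}$ have rows $C_1,\dots,C_p$, let $s\in\mathbb{N}$, and let a connected undirected loop-free graph on the nodes $1,\dots,p$ be given, with symmetric edge weights $a_{ij}$ ($a_{ij}>0$ if $ij$ is an edge, $a_{ij}=0$ otherwise) and Laplacian $\mathcal{L}=\mathrm{diag}\big(\sum_j a_{ij}\big)-(a_{ij})$. Let $\lambda_{\max}(\mathcal{L})$ be the eigenvalue of $\mathcal{L}$ of largest magnitude, and assume that $$\Big(\mathrm{Re}\,\mu-\frac{\lambda^2}{\lambda_{\max}(\mathcal{L})^2}\Big)^2+(\mathrm{Im}\,\mu)^2<1$$ for every eigenvalue $\mu\in\mathbb{C}$ of $A$ with $|\mu|\ge 1$ and every non-zero eigenvalue $\lambda$ of $\mathcal{L}$. Consider the system $x[t+1]=Ax[t]$ with scalar measurements $y_i[t]=C_ix[t]+e_i[t]$ at the nodes $i=1,\dots,p$ ($t=0,1,2,\dots$). An admissible attack is a sequence $e[t]\in\mathbb{R}^p$ for which there is a fixed set $S$ of at most $s$ nodes with $e_i[t]=0$ for all $i\notin S$ and all $t$; the values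 $e_i[t]$, $i\in S$, are arbitrary. A decentralized algorithm runs at each node: in every time slot $t$ node $i$ reads $y_i[t]$, sends one message to each neighbor (determined by its memory and $y_i[t]$), receives one message from each neighbor, updates its memory (from its old memory, $y_i[t]$ and the received messages) and outputs an estimate $\hat x_i[t]\in\mathbb{R}^n$ determined by its memory. The algorithm, including the initial memories, may depend on $A$, $C$, $s$ and the network, but not on $x[0]$, $S$ or $e$; all nodes, attacked or not, execute it correctly. The decentralized secure state-tracking problem is solvable if there is such an algorithm for which $\lim_{t\to\infty}\|\hat x_i[t]-x[t]\|=0$ for every node $i$, every initial state $x[0]\in\mathbb{R}^n$ and every admissible attack. A pair $(A,M)$ is detectable if every $\mu\in\mathbb{C}$ with $Av=\mu v$ and $Mv=0$ for some $v\in\mathbb{C}^n\setminus\{0\}$ satisfies $|\mu|<1$. The pair $(A,C)$ is $k$-sparse detectable if $(A,C_{\mathcal{K}})$ is detectable for every $\mathcal{K}\subseteq\{1,\dots,p\}$ with $|\mathcal{K}|\ge p-k$, where $C_{\mathcal{K}}$ consists of the rows $C_i$, $i\in\mathcal{K}$. Then the decentralized secure state-tracking problem is solvable if and only if $(A,C)$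 is $2s$-sparse detectable. -/

import Mathlib

open Filter Topology

namespace DSST

/-- A weighted undirected graph without loops on the nodes `1, …, p`: the weighted adjacency
matrix is symmetric, positive on the edges and zero elsewhere. -/
structure WeightedGraph (p : ℕ) where
  graph : SimpleGraph (Fin p)
  weight : Matrix (Fin p) (Fin p) ℝ
  weight_symm : weight.IsSymm
  weight_pos : ∀ i j, graph.Adj i j → 0 < weight i j
  weight_zero : ∀ i j, ¬ graph.Adj i j → weight i j = 0

/-- The Laplacian: degree matrix minus weighted adjacency matrix. -/
def WeightedGraph.laplacian {p : ℕ} (N : WeightedGraph p) : Matrix (Fin p) (Fin p) ℝ :=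
  Matrix.diagonal (fun i => ∑ j, N.weight i j) - N.weight

/-- `μ` is the eigenvalue of largest magnitude of the real matrix `M`. -/
def IsLambdaMax {p : ℕ} (M : Matrix (Fin p) (Fin p) ℝ) (μ : ℝ) : Prop :=
  Module.End.HasEigenvalue (Matrix.toLin' M) μ ∧
    ∀ ν : ℝ, Module.End.HasEigenvalue (Matrix.toLin' M) ν → |ν| ≤ |μ|

/-- A real matrix viewed as a complex matrix. -/
def complexify {m n : Type*} (M : Matrix m n ℝ) : Matrix m n ℂ :=
  M.map (fun r : ℝ => (r : ℂ))

/-- The condition relating the unstable eigenvalues `a = Re a + i Im a`, `|a| ≥ 1`, of `A` to the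
non-zero eigenvalues `lam` of the Laplacian `L`:
`(Re a - lam² / lam_max²)² + (Im a)² < 1`. -/
def SpectralCondition {n p : ℕ} (A : Matrix (Fin n) (Fin n) ℝ)
    (L : Matrix (Fin p) (Fin p) ℝ) : Prop :=
  ∀ a : ℂ, Module.End.HasEigenvalue (Matrix.toLin' (complexify A)) a → 1 ≤ ‖a‖ →
    ∀ lam lamMax : ℝ, Module.End.HasEigenvalue (Matrix.toLin' L) lam → lam ≠ 0 →
      IsLambdaMax L lamMax →
        (a.re - lam ^ 2 / lamMax ^ 2) ^ 2 + a.im ^ 2 < 1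

/-- `a` is an unobservable eigenvalue of `A` for the output matrix `C`: some eigenvector of `A`
for `a` is annihilated by `C`. -/
def IsUnobservableEigenvalue {n : ℕ} {ι : Type*} (A : Matrix (Fin n) (Fin n) ℝ)
    (C : Matrix ι (Fin n) ℝ) (a : ℂ) : Prop :=
  ∃ v : Fin n → ℂ, v ≠ 0 ∧ (complexify A).mulVec v = a • v ∧ (complexify C).mulVec v = 0

/-- `(A, C)` is detectable: all unobservable eigenvalues of `A` are stable. -/
def IsDetectable {n : ℕ} {ι : Type*} (A : Matrix (Fin n) (Fin n) ℝ)
    (C : Matrix ι (Fin n) ℝ) : Prop :=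
  ∀ a : ℂ, IsUnobservableEigenvalue A C a → ‖a‖ < 1

/-- The matrix `C_K` that keeps the rows of `C` indexed by `K`. -/
def keepRows {n p : ℕ} (C : Matrix (Fin p) (Fin n) ℝ) (K : Finset (Fin p)) :
    Matrix {i : Fin p // i ∈ K} (Fin n) ℝ :=
  fun i => C i.1

/-- `(A, C)` is `k`-sparse detectable: `(A, C_K)` is detectable for every set `K` of sensors with
`|K| ≥ p - k` (the difference taken in the integers). -/
def IsSparseDetectable {n p : ℕ} (A : Matrix (Fin n) (Fin n) ℝ)
    (C : Matrix (Fin p) (Fin n) ℝ) (k : ℕ) : Prop :=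
  ∀ K : Finset (Fin p), (p : ℤ) - (k : ℤ) ≤ (K.card : ℤ) → IsDetectable A (keepRows C K)

/-- The state trajectory `x[t + 1] = A x[t]`, `x[0] = x₀`. -/
def trajectory {n : ℕ} (A : Matrix (Fin n) (Fin n) ℝ) (x₀ : Fin n → ℝ) : ℕ → Fin n → ℝ
  | 0 => x₀
  | t + 1 => A.mulVec (trajectory A x₀ t)

/-- The measurements `y_i[t] = C_i x[t] + e_i[t]`. -/
def measurement {n p : ℕ} (A : Matrix (Fin n) (Fin n) ℝ) (C : Matrix (Fin p) (Fin n) ℝ)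
    (x₀ : Fin n → ℝ) (e : ℕ → Fin p → ℝ) (t : ℕ) (i : Fin p) : ℝ :=
  C.mulVec (trajectory A x₀ t) i + e t i

/-- An attack signal supported, at all times, on one fixed set of at most `s` sensors; its values
on that set are arbitrary. -/
def IsAttack {p : ℕ} (s : ℕ) (e : ℕ → Fin p → ℝ) : Prop :=
  ∃ S : Finset (Fin p), S.card ≤ s ∧ ∀ t, ∀ i, i ∉ S → e t i = 0

/-- A decentralized algorithm on the communication graph `G`. At every time slot each node reads
its own measurement, sends one message to each of its neighbors, receives theirs, and updates
its memory; its estimate of the state in that slot is read off the updated memory. -/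
structure Algorithm {p : ℕ} (n : ℕ) (G : SimpleGraph (Fin p)) where
  /-- The contents the memory of a node may have. -/
  Mem : Fin p → Type
  /-- The messages that may be sent along an edge. -/
  Msg : Type
  init : (i : Fin p) → Mem i
  /-- From the memory and the current measurement: the message for each neighbor. -/
  send : (i : Fin p) → Mem i → ℝ → G.neighborSet i → Msg
  /-- From the memory, the current measurement and the received messages: the new memory. -/
  update : (i : Fin p) → Mem i → ℝ → (G.neighborSet i → Msg) → Mem i
  estimate : (i : Fin p) → Mem i → (Fin n → ℝ)

/-- The memory of each node at the beginning of time slot `t`, when the sensors deliver the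
measurements `y`. -/
def Algorithm.memory {n p : ℕ} {G : SimpleGraph (Fin p)} (𝒜 : Algorithm n G)
    (y : ℕ → Fin p → ℝ) : ℕ → (i : Fin p) → 𝒜.Mem i
  | 0, i => 𝒜.init i
  | t + 1, i => 𝒜.update i (𝒜.memory y t i) (y t i)
      (fun j => 𝒜.send j.1 (𝒜.memory y t j.1) (y t j.1) ⟨i, SimpleGraph.Adj.symm j.2⟩)

/-- The estimate of node `i` in time slot `t`. -/
def Algorithm.output {n p : ℕ} {G : SimpleGraph (Fin p)} (𝒜 : Algorithm n G)
    (y : ℕ → Fin p → ℝ) (t : ℕ) (i : Fin p) : Fin n → ℝ :=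
  𝒜.estimate i (𝒜.memory y (t + 1) i)

/-- The algorithm solves the decentralized secure state-tracking problem: for every initial state
and every admissible attack, the estimate of every node converges to the state in the Euclidean
norm. -/
def Algorithm.Solves {n p : ℕ} {G : SimpleGraph (Fin p)} (𝒜 : Algorithm n G)
    (A : Matrix (Fin n) (Fin n) ℝ) (C : Matrix (Fin p) (Fin n) ℝ) (s : ℕ) : Prop :=
  ∀ (x₀ : Fin n → ℝ) (e : ℕ → Fin p → ℝ), IsAttack s e → ∀ i : Fin p,
    Tendsto (fun t : ℕ =>
      ‖WithLp.toLp 2 (𝒜.output (measurement A C x₀ e) t i - trajectory A x₀ t)‖) atTop (𝓝 0)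

/-- The decentralized secure state-tracking problem is solvable. The algorithm may depend on the
system, on the network and on `s`, but not on the initial state or the attack. -/
def Solvable {n p : ℕ} (A : Matrix (Fin n) (Fin n) ℝ) (C : Matrix (Fin p) (Fin n) ℝ) (s : ℕ)
    (G : SimpleGraph (Fin p)) : Prop :=
  ∃ 𝒜 : Algorithm n G, 𝒜.Solves A C s

end DSST

/-! Necessity: a trajectory invisible outside 2s sensors can be forged. Splitting those sensors into
two sets of size at most s, one attack hides the trajectory and another, on the zero state, imitates
what remains; equal measurements force equal estimates, so the trajectory decays
(`Algorithm.Solves.tendsto_pow_mulVec`). Sufficiency: measurements are flooded, and each node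
propagates by `A ^ t` an initial state that agrees with the data of at least p - s nodes. It shares
at least p - 2s honest nodes with the true state, so the difference is invisible there on a finite
window and decays (`IsDetectable.exists_decay`). Near-minimal norm of the guesses makes the decay
uniform, although they change with time. -/

namespace DSST

/-! ### Detectability and decay of invisible trajectories -/

section Decay

/-- In a complex Banach algebra the powers of an element whose spectrum lies in the open unit
disc tend to zero. -/
theorem tendsto_norm_pow_of_spectrum_lt_one {B : Type*} [NormedRing B] [NormedAlgebra ℂ B]
    [CompleteSpace B] [Nontrivial B] (b : B) (h : ∀ k ∈ spectrum ℂ b, ‖k‖ < 1) :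
    Tendsto (fun k : ℕ => ‖b ^ k‖) atTop (𝓝 0) := by
  have hr : spectralRadius ℂ b < ((1 : NNReal) : ENNReal) :=
    spectrum.spectralRadius_lt_of_forall_lt b fun k hk => by
      have := h k hk
      rwa [← coe_nnnorm, ← NNReal.coe_one, NNReal.coe_lt_coe] at this
  obtain ⟨r, hr₁, hr₂⟩ := ENNReal.lt_iff_exists_nnreal_btwn.1 hr
  -- Gelfand's formula: eventually `‖b ^ k‖ ^ (1 / k) < r < 1`.
  have hev := (spectrum.pow_nnnorm_pow_one_div_tendsto_nhds_spectralRadius b).eventually_lt_const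
    hr₁
  have hr1 : (r : ℝ) < 1 := by exact_mod_cast hr₂
  refine squeeze_zero' (Eventually.of_forall fun _ => norm_nonneg _) ?_
    (tendsto_pow_atTop_nhds_zero_of_lt_one r.coe_nonneg hr1)
  filter_upwards [hev, eventually_gt_atTop 0] with k hk hk0
  have hk0' : (k : ℝ) ≠ 0 := by positivity
  have h2 : (‖b ^ k‖₊ : ENNReal) ≤ (r : ENNReal) ^ (k : ℝ) := by
    have := ENNReal.rpow_le_rpow hk.le (Nat.cast_nonneg (α := ℝ) k)
    rwa [← ENNReal.rpow_mul, one_div, inv_mul_cancel₀ hk0', ENNReal.rpow_one] at this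
  rw [ENNReal.rpow_natCast] at h2
  exact_mod_cast h2

/-- The powers of an endomorphism of a finite-dimensional complex space, all of whose eigenvalues
lie in the open unit disc, tend to zero uniformly on bounded sets. -/
theorem exists_tendsto_zero_norm_pow_apply_le {V : Type*} [NormedAddCommGroup V]
    [NormedSpace ℂ V] [FiniteDimensional ℂ V] (f : Module.End ℂ V)
    (h : ∀ a : ℂ, f.HasEigenvalue a → ‖a‖ < 1) :
    ∃ c : ℕ → ℝ, Tendsto c atTop (𝓝 0) ∧ ∀ k v, ‖(f ^ k) v‖ ≤ c k * ‖v‖ := by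
  rcases subsingleton_or_nontrivial V with hV | hV
  · exact ⟨0, tendsto_const_nhds, fun k v => by simp [Subsingleton.elim ((f ^ k) v) 0]⟩
  have : CompleteSpace V := FiniteDimensional.complete ℂ V
  let e := Module.End.toContinuousLinearMap (𝕜 := ℂ) V
  refine ⟨fun k => ‖(e f) ^ k‖, tendsto_norm_pow_of_spectrum_lt_one _ fun a ha => ?_,
    fun k v => ?_⟩
  · rw [AlgEquiv.spectrum_eq] at ha
    exact h a (Module.End.hasEigenvalue_iff_mem_spectrum.2 ha)
  · simp only [← map_pow]
    exact (e (f ^ k)).le_opNorm v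

/-- The vectors that the output matrix `M` does not see during the first `T` steps of `A`. -/
def unobservableSubmodule {n : ℕ} {ι : Type*} (A : Matrix (Fin n) (Fin n) ℂ)
    (M : Matrix ι (Fin n) ℂ) (T : ℕ) : Submodule ℂ (Fin n → ℂ) where
  carrier := {v | ∀ t < T, M.mulVec ((A ^ t).mulVec v) = 0}
  add_mem' := fun {v w} hv hw t ht => by
    rw [Matrix.mulVec_add, Matrix.mulVec_add, hv t ht, hw t ht, add_zero]
  zero_mem' := fun t _ => by rw [Matrix.mulVec_zero, Matrix.mulVec_zero]
  smul_mem' := fun c v hv t ht => by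
    rw [Matrix.mulVec_smul, Matrix.mulVec_smul, hv t ht, smul_zero]

theorem mem_unobservableSubmodule {n : ℕ} {ι : Type*} {A : Matrix (Fin n) (Fin n) ℂ}
    {M : Matrix ι (Fin n) ℂ} {T : ℕ} {v : Fin n → ℂ} :
    v ∈ unobservableSubmodule A M T ↔ ∀ t < T, M.mulVec ((A ^ t).mulVec v) = 0 :=
  Iff.rfl

/-- A decreasing chain of subspaces in finite dimension stabilizes; `0 < T` ensures that the output
at time 0 is in the window. -/
theorem exists_unobservableSubmodule_succ_eq {n : ℕ} {ι : Type*} (A : Matrix (Fin n) (Fin n) ℂ)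
    (M : Matrix ι (Fin n) ℂ) :
    ∃ T, 0 < T ∧ unobservableSubmodule A M T = unobservableSubmodule A M (T + 1) := by
  let F : ℕ →o (Submodule ℂ (Fin n → ℂ))ᵒᵈ :=
    ⟨fun T => OrderDual.toDual (unobservableSubmodule A M T),
      fun T T' h => OrderDual.toDual_le_toDual.2 fun v hv t ht => hv t (ht.trans_le h)⟩
  obtain ⟨T, hT⟩ := IsArtinian.monotone_stabilizes F
  exact ⟨T + 1, T.succ_pos, (hT (T + 1) (by omega)).symm.trans (hT (T + 2) (by omega))⟩

theorem complexify_mulVec {m n : Type*} [Fintype n] (M : Matrix m n ℝ) (v : n → ℝ) :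
    (complexify M).mulVec (fun i => (v i : ℂ)) = fun i => ((M.mulVec v i : ℝ) : ℂ) := by
  ext i
  simp [complexify, Matrix.mulVec, dotProduct]

theorem complexify_pow {n : ℕ} (A : Matrix (Fin n) (Fin n) ℝ) (t : ℕ) :
    complexify (A ^ t) = complexify A ^ t :=
  map_pow (Complex.ofRealHom.mapMatrix (m := Fin n)) A t

theorem norm_ofReal_comp {n : ℕ} (v : Fin n → ℝ) : ‖fun i => (v i : ℂ)‖ = ‖v‖ := by
  simp [Pi.norm_def]

/-- If `(A, M)` is detectable, then trajectories that are invisible during a certain finite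
time window decay, uniformly in the initial state. -/
theorem IsDetectable.exists_decay {n : ℕ} {ι : Type*} {A : Matrix (Fin n) (Fin n) ℝ}
    {M : Matrix ι (Fin n) ℝ} (h : IsDetectable A M) :
    ∃ (T : ℕ) (c : ℕ → ℝ), Tendsto c atTop (𝓝 0) ∧
      ∀ d : Fin n → ℝ, (∀ t < T, M.mulVec ((A ^ t).mulVec d) = 0) →
        ∀ k, ‖(A ^ k).mulVec d‖ ≤ c k * ‖d‖ := by
  obtain ⟨T, hT0, hT⟩ := exists_unobservableSubmodule_succ_eq (complexify A) (complexify M)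
  set U := unobservableSubmodule (complexify A) (complexify M) T with hU
  have hinv : ∀ v ∈ U, Matrix.toLin' (complexify A) v ∈ U := by
    intro v hv t ht
    -- Stabilization supplies the extra step lost by applying `A`.
    rw [hT] at hv
    rw [Matrix.toLin'_apply, Matrix.mulVec_mulVec (M := complexify A ^ t), ← pow_succ]
    exact hv (t + 1) (by omega)
  obtain ⟨c, hc, hcv⟩ := exists_tendsto_zero_norm_pow_apply_le
    ((Matrix.toLin' (complexify A)).restrict hinv) fun a ha => by
      obtain ⟨v, hv⟩ := ha.exists_hasEigenvector
      refine h a ⟨v, fun h0 => hv.2 (Subtype.ext h0), ?_, ?_⟩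
      · simpa using congrArg Subtype.val hv.apply_eq_smul
      · simpa using v.2 0 hT0
  refine ⟨T, c, hc, fun d hd k => ?_⟩
  have hdU : (fun i => (d i : ℂ)) ∈ U := by
    intro t ht
    rw [← complexify_pow, complexify_mulVec, complexify_mulVec, hd t ht]
    ext i
    simp
  have := hcv k ⟨_, hdU⟩
  rw [Module.End.pow_restrict k, Submodule.coe_norm, Submodule.coe_norm,
    LinearMap.coe_restrict_apply, ← Matrix.toLin'_pow, Matrix.toLin'_apply, ← complexify_pow,
    complexify_mulVec, norm_ofReal_comp, norm_ofReal_comp] at this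
  exact this

end Decay

theorem trajectory_eq {n : ℕ} (A : Matrix (Fin n) (Fin n) ℝ) (x₀ : Fin n → ℝ) (t : ℕ) :
    trajectory A x₀ t = (A ^ t).mulVec x₀ := by
  induction t with
  | zero => simp [trajectory]
  | succ t ih => rw [trajectory, ih, Matrix.mulVec_mulVec, ← pow_succ']

theorem keepRows_mulVec_eq_zero_iff {n p : ℕ} {C : Matrix (Fin p) (Fin n) ℝ} {K : Finset (Fin p)}
    {v : Fin n → ℝ} : (keepRows C K).mulVec v = 0 ↔ ∀ i ∈ K, C.mulVec v i = 0 :=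
  ⟨fun h i hi => congrFun h ⟨i, hi⟩, fun h => funext fun i => h i.1 i.2⟩

theorem tendsto_norm_toLp_zero_iff {n : ℕ} {v : ℕ → Fin n → ℝ} :
    Tendsto (fun t => ‖WithLp.toLp 2 (v t)‖) atTop (𝓝 0) ↔ Tendsto v atTop (𝓝 0) := by
  rw [← tendsto_zero_iff_norm_tendsto_zero]
  constructor
  · intro h
    exact ((PiLp.continuous_ofLp 2 (fun _ : Fin n => ℝ)).tendsto 0).comp h
  · intro h
    exact ((PiLp.continuous_toLp 2 (fun _ : Fin n => ℝ)).tendsto 0).comp h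

/-! ### Necessity: indistinguishable attacks -/

section Necessity

/-- If the problem is solvable, then every trajectory that is invisible to at least `p - 2s`
sensors decays. -/
theorem Algorithm.Solves.tendsto_pow_mulVec {n p : ℕ} {G : SimpleGraph (Fin p)}
    {𝒜 : Algorithm n G} {A : Matrix (Fin n) (Fin n) ℝ} {C : Matrix (Fin p) (Fin n) ℝ} {s : ℕ}
    (h : 𝒜.Solves A C s) (i₀ : Fin p) {K : Finset (Fin p)}
    (hK : (p : ℤ) - ((2 * s : ℕ) : ℤ) ≤ (K.card : ℤ)) {w : Fin n → ℝ}
    (hw : ∀ t, ∀ i ∈ K, C.mulVec ((A ^ t).mulVec w) i = 0) :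
    Tendsto (fun t => (A ^ t).mulVec w) atTop (𝓝 0) := by
  have hcard : Kᶜ.card ≤ 2 * s := by
    have := Finset.card_add_card_compl K
    rw [Fintype.card_fin] at this
    push_cast at hK
    omega
  -- `S` takes as much of `Kᶜ` as one attack can cover; at most `s` sensors remain.
  obtain ⟨S, hSK, hS⟩ := Finset.exists_subset_card_eq (min_le_right s Kᶜ.card)
  have hS' : (Kᶜ \ S).card ≤ s := by
    have := Finset.card_sdiff_add_card_eq_card hSK
    omega
  let e₁ : ℕ → Fin p → ℝ := fun t i => if i ∈ S then -C.mulVec ((A ^ t).mulVec w) i else 0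
  let e₂ : ℕ → Fin p → ℝ := fun t i => if i ∈ Kᶜ \ S then C.mulVec ((A ^ t).mulVec w) i else 0
  have he₁ : IsAttack s e₁ := ⟨S, hS.trans_le (min_le_left _ _), fun t i hi => if_neg hi⟩
  have he₂ : IsAttack s e₂ := ⟨Kᶜ \ S, hS', fun t i hi => if_neg hi⟩
  have hmeas : measurement A C w e₁ = measurement A C 0 e₂ := by
    funext t i
    simp only [measurement, trajectory_eq, Matrix.mulVec_zero, Pi.zero_apply, e₁, e₂,
      Finset.mem_sdiff, Finset.mem_compl]
    by_cases hiK : i ∈ K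
    · simp [hw t i hiK]
    · by_cases hiS : i ∈ S <;> simp [hiK, hiS]
  have h₁ := tendsto_norm_toLp_zero_iff.1 (h w e₁ he₁ i₀)
  have h₂ := tendsto_norm_toLp_zero_iff.1 (h 0 e₂ he₂ i₀)
  rw [hmeas] at h₁
  simpa [trajectory_eq] using h₂.sub h₁

theorem isSparseDetectable_of_solvable {n p : ℕ} {A : Matrix (Fin n) (Fin n) ℝ}
    {C : Matrix (Fin p) (Fin n) ℝ} {s : ℕ} {G : SimpleGraph (Fin p)} (i₀ : Fin p)
    (h : Solvable A C s G) : IsSparseDetectable A C (2 * s) := by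
  obtain ⟨𝒜, h𝒜⟩ := h
  rintro K hK a ⟨v, hv0, hAv, hCv⟩
  have hpow : ∀ t : ℕ, (complexify A ^ t).mulVec v = a ^ t • v := by
    intro t
    induction t with
    | zero => simp
    | succ t ih =>
      rw [pow_succ, ← Matrix.mulVec_mulVec, hAv, Matrix.mulVec_smul, ih, smul_smul, pow_succ']
  -- Initial states are real, so the complex eigenvector is split into real and imaginary parts.
  have hre : ∀ {m : ℕ} (M : Matrix (Fin m) (Fin n) ℝ) (u : Fin n → ℂ) i,
      M.mulVec (fun j => (u j).re) i = ((complexify M).mulVec u i).re := by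
    intro m M u i
    simp [complexify, Matrix.mulVec, dotProduct]
  have him : ∀ {m : ℕ} (M : Matrix (Fin m) (Fin n) ℝ) (u : Fin n → ℂ) i,
      M.mulVec (fun j => (u j).im) i = ((complexify M).mulVec u i).im := by
    intro m M u i
    simp [complexify, Matrix.mulVec, dotProduct]
  have hCi : ∀ (t : ℕ), ∀ i ∈ K, (complexify C).mulVec (a ^ t • v) i = 0 := by
    intro t i hi
    have h0 : (complexify C).mulVec v i = 0 := congrFun hCv ⟨i, hi⟩
    rw [Matrix.mulVec_smul, Pi.smul_apply, h0, smul_zero]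
  have hAre : ∀ t : ℕ, (A ^ t).mulVec (fun j => (v j).re) = fun j => ((a ^ t • v) j).re := by
    intro t
    ext j
    rw [hre, complexify_pow, hpow]
  have hAim : ∀ t : ℕ, (A ^ t).mulVec (fun j => (v j).im) = fun j => ((a ^ t • v) j).im := by
    intro t
    ext j
    rw [him, complexify_pow, hpow]
  have h₁ := h𝒜.tendsto_pow_mulVec i₀ hK (w := fun j => (v j).re) fun t i hi => by
    rw [hAre, hre, hCi t i hi, Complex.zero_re]
  have h₂ := h𝒜.tendsto_pow_mulVec i₀ hK (w := fun j => (v j).im) fun t i hi => by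
    rw [hAim, him, hCi t i hi, Complex.zero_im]
  simp only [hAre] at h₁
  simp only [hAim] at h₂
  by_contra ha
  rw [not_lt] at ha
  obtain ⟨j, hj⟩ := Function.ne_iff.1 hv0
  have h₃ := ((tendsto_pi_nhds.1 h₁ j).abs).add ((tendsto_pi_nhds.1 h₂ j).abs)
  -- Since `1 ≤ ‖a‖`, the mode `a ^ t • v` never falls below `‖v j‖` in coordinate `j`, yet both of
  -- its parts tend to zero.
  have h₄ : ‖v j‖ ≤ |(0 : Fin n → ℝ) j| + |(0 : Fin n → ℝ) j| :=
    ge_of_tendsto' h₃ fun t => by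
      refine le_trans ?_ (Complex.norm_le_abs_re_add_abs_im _)
      rw [Pi.smul_apply, norm_smul, norm_pow]
      exact le_mul_of_one_le_left (norm_nonneg _) (one_le_pow₀ ha)
  simp only [Pi.zero_apply, abs_zero, add_zero] at h₄
  exact hj (norm_le_zero_iff.1 h₄)

end Necessity

/-! ### Sufficiency: flooding and consistent guesses -/

section Sufficiency

/-- Flooding: every node remembers the time and all the triples (time, node, measurement) it has
learned, sends all of them to its neighbors, and computes its estimate from them. -/
def flooding {n p : ℕ} (G : SimpleGraph (Fin p))
    (est : ℕ → Set (ℕ × Fin p × ℝ) → (Fin n → ℝ)) : Algorithm n G where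
  Mem _ := ℕ × Set (ℕ × Fin p × ℝ)
  Msg := Set (ℕ × Fin p × ℝ)
  init _ := (0, ∅)
  send i m y _ := insert (m.1, i, y) m.2
  update i m y msg := (m.1 + 1, insert (m.1, i, y) m.2 ∪ ⋃ j, msg j)
  -- The estimate for slot `t` is read after the update, when the clock shows `t + 1`.
  estimate _ m := est (m.1 - 1) m.2

variable {n p : ℕ} {G : SimpleGraph (Fin p)} {est : ℕ → Set (ℕ × Fin p × ℝ) → (Fin n → ℝ)}

theorem flooding_memory_fst (y : ℕ → Fin p → ℝ) (t : ℕ) (i : Fin p) :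
    ((flooding G est).memory y t i).1 = t := by
  induction t with
  | zero => rfl
  | succ t ih => exact congrArg (· + 1) ih

theorem flooding_output (y : ℕ → Fin p → ℝ) (t : ℕ) (i : Fin p) :
    (flooding G est).output y t i = est t ((flooding G est).memory y (t + 1) i).2 :=
  congrArg (fun c => est (c - 1) ((flooding G est).memory y (t + 1) i).2)
    (flooding_memory_fst y (t + 1) i)

theorem flooding_memory_succ_snd (y : ℕ → Fin p → ℝ) (t : ℕ) (i : Fin p) :
    ((flooding G est).memory y (t + 1) i).2 =
      insert (t, i, y t i) ((flooding G est).memory y t i).2 ∪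
        ⋃ j : G.neighborSet i, insert (t, j.1, y t j.1) ((flooding G est).memory y t j.1).2 := by
  have h : ((flooding G est).memory y (t + 1) i).2 =
      insert (((flooding G est).memory y t i).1, i, y t i) ((flooding G est).memory y t i).2 ∪
        ⋃ j : G.neighborSet i, insert (((flooding G est).memory y t j.1).1, j.1, y t j.1)
          ((flooding G est).memory y t j.1).2 := rfl
  simpa only [flooding_memory_fst] using h

theorem eq_of_mem_flooding_memory {y : ℕ → Fin p → ℝ} {t : ℕ} {i : Fin p} {f : ℕ × Fin p × ℝ}
    (hf : f ∈ ((flooding G est).memory y t i).2) : f.2.2 = y f.1 f.2.1 := by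
  induction t generalizing i with
  | zero => exact hf.elim
  | succ t ih =>
    rw [flooding_memory_succ_snd] at hf
    simp only [Set.mem_union, Set.mem_insert_iff, Set.mem_iUnion] at hf
    rcases hf with (rfl | hf) | ⟨j, rfl | hf⟩
    · rfl
    · exact ih hf
    · rfl
    · exact ih hf

theorem mem_flooding_memory_self {y : ℕ → Fin p → ℝ} {t τ : ℕ} (i : Fin p) (h : τ < t) :
    (τ, i, y τ i) ∈ ((flooding G est).memory y t i).2 := by
  induction t with
  | zero => omega
  | succ t ih =>
    rw [flooding_memory_succ_snd]
    rcases Nat.lt_succ_iff_lt_or_eq.1 h with h | rfl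
    · exact Or.inl (Or.inr (ih h))
    · exact Or.inl (Or.inl rfl)

/-- A measurement reaches every node within a delay equal to the length of a walk. -/
theorem mem_flooding_memory_of_walk {y : ℕ → Fin p → ℝ} {i j : Fin p} (w : G.Walk i j)
    {t τ : ℕ} (h : τ + w.length < t) :
    (τ, j, y τ j) ∈ ((flooding G est).memory y t i).2 := by
  induction w generalizing t with
  | nil => exact mem_flooding_memory_self _ (by simpa using h)
  | @cons i k j hik w ih =>
    rw [SimpleGraph.Walk.length_cons] at h
    obtain ⟨t, rfl⟩ : ∃ t', t = t' + 1 := ⟨t - 1, by omega⟩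
    rw [flooding_memory_succ_snd]
    exact Or.inr (Set.mem_iUnion.2 ⟨⟨k, hik⟩, Or.inr (ih (by omega))⟩)

/-- The initial state `x` explains, for some set of at least `p - s` nodes, all the given
measurements at these nodes. -/
def IsConsistent (A : Matrix (Fin n) (Fin n) ℝ) (C : Matrix (Fin p) (Fin n) ℝ) (s : ℕ)
    (F : Set (ℕ × Fin p × ℝ)) (x : Fin n → ℝ) : Prop :=
  ∃ K : Finset (Fin p), (p : ℤ) - (s : ℤ) ≤ (K.card : ℤ) ∧
    ∀ f ∈ F, f.2.1 ∈ K → f.2.2 = C.mulVec ((A ^ f.1).mulVec x) f.2.1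

/-- The infimum of the norms need not be attained; slack 1 suffices for a bounded choice. -/
theorem exists_norm_le_add_one {E : Type*} [SeminormedAddCommGroup E] (P : E → Prop) :
    ∃ x, ∀ z, P z → P x ∧ ‖x‖ ≤ ‖z‖ + 1 := by
  by_cases hP : ∃ z, P z
  · have hne : (norm '' {z | P z}).Nonempty := Set.Nonempty.image _ hP
    have hbdd : BddBelow (norm '' {z | P z}) := ⟨0, by rintro _ ⟨z, -, rfl⟩; exact norm_nonneg z⟩
    obtain ⟨_, ⟨x, hx, rfl⟩, hlt⟩ := exists_lt_of_csInf_lt hne (lt_add_one _)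
    exact ⟨x, fun z hz => ⟨hx, hlt.le.trans (by gcongr; exact csInf_le hbdd ⟨z, hz, rfl⟩)⟩⟩
  · exact ⟨0, fun z hz => (hP ⟨z, hz⟩).elim⟩

theorem sub_le_card_inter {K K' : Finset (Fin p)} {s : ℕ} (hK : (p : ℤ) - (s : ℤ) ≤ (K.card : ℤ))
    (hK' : (p : ℤ) - (s : ℤ) ≤ (K'.card : ℤ)) :
    (p : ℤ) - ((2 * s : ℕ) : ℤ) ≤ ((K ∩ K').card : ℤ) := by
  have h₁ := Finset.card_union_add_card_inter K K'
  have h₂ := card_finset_fin_le (K ∪ K')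
  push_cast
  omega

theorem solvable_of_isSparseDetectable {A : Matrix (Fin n) (Fin n) ℝ}
    {C : Matrix (Fin p) (Fin n) ℝ} {s : ℕ} (hG : G.Preconnected)
    (h : IsSparseDetectable A C (2 * s)) : Solvable A C s G := by
  choose guess hguess using fun F : Set (ℕ × Fin p × ℝ) =>
    exists_norm_le_add_one (IsConsistent A C s F)
  refine ⟨flooding G fun t F => (A ^ t).mulVec (guess F), ?_⟩
  rintro x₀ e ⟨S, hS, he⟩ i
  rw [tendsto_norm_toLp_zero_iff]
  set 𝒜 := flooding G fun t F => (A ^ t).mulVec (guess F)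
  set y := measurement A C x₀ e with hy
  set F : ℕ → Set (ℕ × Fin p × ℝ) := fun t => (𝒜.memory y (t + 1) i).2
  have hyS : ∀ t, ∀ j ∈ Sᶜ, y t j = C.mulVec ((A ^ t).mulVec x₀) j := fun t j hj => by
    rw [hy, measurement, trajectory_eq, he t j (Finset.mem_compl.1 hj), add_zero]
  have hScard : (p : ℤ) - (s : ℤ) ≤ (Sᶜ.card : ℤ) := by
    have := Finset.card_add_card_compl S
    rw [Fintype.card_fin] at this
    omega
  have hcons : ∀ t, IsConsistent A C s (F t) x₀ := fun t =>
    ⟨Sᶜ, hScard, fun f hf hfS => (eq_of_mem_flooding_memory hf).trans (hyS _ _ hfS)⟩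
  have hout : ∀ t, 𝒜.output y t i - trajectory A x₀ t = (A ^ t).mulVec (guess (F t) - x₀) := by
    intro t
    rw [flooding_output, trajectory_eq, Matrix.mulVec_sub]
  have hnorm : ∀ t, ‖guess (F t) - x₀‖ ≤ 2 * ‖x₀‖ + 1 := fun t => by
    have h₁ := norm_sub_le (guess (F t)) x₀
    have h₂ := (hguess (F t) x₀ (hcons t)).2
    linarith
  -- Sets `J` that are too small get dummy values, so that `T` and `c` are defined for every `J`.
  have hdecay : ∀ J : Finset (Fin p), ∃ (T : ℕ) (c : ℕ → ℝ), Tendsto c atTop (𝓝 0) ∧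
      ((p : ℤ) - ((2 * s : ℕ) : ℤ) ≤ (J.card : ℤ) → ∀ d : Fin n → ℝ,
        (∀ t < T, (keepRows C J).mulVec ((A ^ t).mulVec d) = 0) →
          ∀ k, ‖(A ^ k).mulVec d‖ ≤ c k * ‖d‖) := by
    intro J
    by_cases hJ : (p : ℤ) - ((2 * s : ℕ) : ℤ) ≤ (J.card : ℤ)
    · obtain ⟨T, c, hc, hd⟩ := (h J hJ).exists_decay
      exact ⟨T, c, hc, fun _ => hd⟩
    · exact ⟨0, 0, tendsto_const_nhds, fun hJ' => (hJ hJ').elim⟩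
  choose T c hc hd using hdecay
  let w : ∀ j, G.Walk i j := fun j => (hG i j).some
  -- The set `Sᶜ ∩ K` varies with `t`; summing over all `J` gives one bound for every case.
  have hbound : Tendsto (fun t => (∑ J, |c J t|) * (2 * ‖x₀‖ + 1)) atTop (𝓝 0) := by
    have := (tendsto_finsetSum Finset.univ fun J _ => (hc J).abs).mul_const (2 * ‖x₀‖ + 1)
    simpa using this
  have hev : ∀ᶠ t : ℕ in atTop, ∀ J j, T J + (w j).length ≤ t :=
    eventually_all.2 fun J => eventually_all.2 fun j => eventually_ge_atTop _
  refine squeeze_zero_norm' ?_ hbound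
  filter_upwards [hev] with t ht
  rw [hout]
  obtain ⟨K, hK, hKF⟩ := (hguess (F t) x₀ (hcons t)).1
  refine (hd (Sᶜ ∩ K) (sub_le_card_inter hScard hK) _ (fun τ hτ => ?_) t).trans ?_
  · rw [keepRows_mulVec_eq_zero_iff]
    intro j hj
    rw [Finset.mem_inter] at hj
    have hmem : (τ, j, y τ j) ∈ F t :=
      mem_flooding_memory_of_walk (w j) (by have := ht (Sᶜ ∩ K) j; omega)
    have h₁ := hKF _ hmem hj.2
    rw [Matrix.mulVec_sub, Matrix.mulVec_sub, Pi.sub_apply, sub_eq_zero, ← hyS τ j hj.1]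
    exact h₁.symm
  · refine mul_le_mul ?_ (hnorm t) (norm_nonneg _) (Finset.sum_nonneg fun _ _ => abs_nonneg _)
    exact (le_abs_self _).trans
      (Finset.single_le_sum (f := fun J => |c J t|) (fun _ _ => abs_nonneg _)
        (Finset.mem_univ (Sᶜ ∩ K)))

end Sufficiency

end DSST

theorem mainTheorem1 {n p : ℕ} (A : Matrix (Fin n) (Fin n) ℝ) (C : Matrix (Fin p) (Fin n) ℝ)
    (s : ℕ) (N : DSST.WeightedGraph p) (hconn : N.graph.Connected)
    (hspec : DSST.SpectralCondition A N.laplacian) :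
    DSST.Solvable A C s N.graph ↔ DSST.IsSparseDetectable A C (2 * s) :=
  ⟨DSST.isSparseDetectable_of_solvable hconn.nonempty.some,
    DSST.solvable_of_isSparseDetectable hconn.preconnected⟩
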